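/- A unit square is a closed solid square of edge length $1$, in any position in the Euclidean plane. For $n\ge 1$ let $S(n)$ be the largest edge length of a closed square that can be covered by $n$ unit squares, and let $S_{\mathrm{bd}}(n)$ be the largest edge length of a square whose boundary can be covered by $n$ unit squares. Let $\varphi=\frac{1+\sqrt5}{2}$. Then $$S_{\mathrm{bd}}(2)=S(2)=1\qquad\text{and}\qquad S_{\mathrm{bd}}(3)=S(3)=\sqrt{\varphi}$$ (in particular, all these maxima are attained). Furthermore, let $\mathcal F$ be a family of $n$ unit squares covering the boundary of a square $S$ of edge length $S_{\mathrm{bd}}(n)$. - If $n=2$, then at least one element of $\mathcal F$ is a translate of $S$. - If $n=3$, then, up to a congruence of the plane, $S=[0,\sqrt\varphi]^2$ and the three elements of $\mathcal F$ are, in some order, the following squares $S_1,S_2,S_3$. The squares $S_1$ and $S_2$ are the images of $[0,1]^2$ under the rotations about the origin by the angles $-\alpha$ and $\alpha$, where $\alpha=\arccos\frac{1}{\sqrt\varphi}$, and $S_3=[\sqrt\varphi-1,\sqrt\varphi]^2$ is the homothetic copy of $S$ of edge length $1$ whose homothety center is the vertex $(\sqrt\varphi,\sqrt\varphi)$ of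 $S$. -/

import Mathlib

/-- The Euclidean plane. -/
abbrev Plane : Type := EuclideanSpace ℝ (Fin 2)

/-- The closed axis-parallel square `[0, a] × [0, a]`. -/
def stdSquare (a : ℝ) : Set Plane := {x | ∀ i, x i ∈ Set.Icc 0 a}

/-- `Q` is a (closed, solid) square of edge length `a > 0` in the plane, in any position:
a congruent copy of `[0, a] × [0, a]`. -/
def IsSquareOfEdge (a : ℝ) (Q : Set Plane) : Prop :=
  0 < a ∧ ∃ g : Plane ≃ᵢ Plane, Q = g '' stdSquare a

/-- The edge lengths of the squares that can be covered with `n` unit squares. -/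
def coverableEdges (n : ℕ) : Set ℝ :=
  {a | ∃ (S : Set Plane) (F : Fin n → Set Plane),
    IsSquareOfEdge a S ∧ (∀ i, IsSquareOfEdge 1 (F i)) ∧ S ⊆ ⋃ i, F i}

/-- The edge lengths of the squares whose boundary can be covered with `n` unit squares. -/
def bdCoverableEdges (n : ℕ) : Set ℝ :=
  {a | ∃ (S : Set Plane) (F : Fin n → Set Plane),
    IsSquareOfEdge a S ∧ (∀ i, IsSquareOfEdge 1 (F i)) ∧ frontier S ⊆ ⋃ i, F i}

/-- `s` is the value `S(n)`: the largest edge length of a square that can be covered with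
`n` unit squares. -/
def IsS (n : ℕ) (s : ℝ) : Prop := IsGreatest (coverableEdges n) s

/-- `s` is the value `S_bd(n)`: the largest edge length of a square whose boundary can be
covered with `n` unit squares. -/
def IsSbd (n : ℕ) (s : ℝ) : Prop := IsGreatest (bdCoverableEdges n) s

/-- Counterclockwise rotation about the origin by the angle `θ`. -/
noncomputable def rot (θ : ℝ) (x : Plane) : Plane :=
  !₂[Real.cos θ * x 0 - Real.sin θ * x 1, Real.sin θ * x 0 + Real.cos θ * x 1]

/-- The edge length `√φ`, where `φ` is the golden ratio. -/
noncomputable def sqrtPhi : ℝ := Real.sqrt Real.goldenRatio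

/-- The three unit squares of the extremal configuration for `S = [0, √φ] × [0, √φ]`:
with `α = arccos (1 / √φ)`, the rotated copies of `[0, 1] × [0, 1]` by `-α` and by `α` about
the vertex `(0, 0)` of `S`, and the homothetic copy of `S` of edge length `1` with the
vertex `(√φ, √φ)` of `S` as homothety center. -/
noncomputable def extremalSquares : Fin 3 → Set Plane :=
  ![rot (-Real.arccos (1 / sqrtPhi)) '' stdSquare 1,
    rot (Real.arccos (1 / sqrtPhi)) '' stdSquare 1,
    AffineMap.homothety (!₂[sqrtPhi, sqrtPhi] : Plane) (1 / sqrtPhi) '' stdSquare sqrtPhi]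

/-!
A right triangle in a unit square with one leg `b ≥ 1` has a second leg of length at most
`b - b √(b² - 1)`. Let three unit squares cover the boundary of `[0, a]²` with `a ≥ √φ`. No unit
square contains two opposite corners, so one of them contains two adjacent corners, say the bottom
ones. The top corners then lie in the two other squares, which meet the first one at points `(0, l)`
and `(a, t)` and each other at a point `(p, a)`. The first square forces `l ≤ 1 / 6` and
`t + l / 2 ≤ √φ - 1`, up to a reflection. The other two contain right triangles with the legs
`a - l` and `p`, and `a - t` and `a - p`. Bounding `p` and `a - p` by the maximal second legs
yields `a ≤ √φ - l / 10`. Hence `a = √φ` and `l = 0`, all estimates are sharp, and the sharp cases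
determine the three squares. Two unit squares are treated likewise, by the width of a unit square
that contains a diagonal or the corners of a trapezoid.
-/

/-! ### The longest second leg of a right triangle in a unit square -/

lemma le_one_of_sq_add_sq_eq_one {c s : ℝ} (h : c ^ 2 + s ^ 2 = 1) : c ≤ 1 := by
  nlinarith [sq_nonneg s, sq_nonneg (c - 1)]

/-- The longest second leg of a right triangle contained in a unit square and having one leg of
length `b ≥ 1`. -/
noncomputable def maxLeg (b : ℝ) : ℝ := b - b * √(b ^ 2 - 1)

lemma sq_sub_maxLeg {b : ℝ} (hb : 1 ≤ b) : (b - maxLeg b) ^ 2 = b ^ 2 * (b ^ 2 - 1) := by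
  rw [maxLeg, sub_sub_cancel, mul_pow, Real.sq_sqrt (by nlinarith)]

lemma maxLeg_le {b P : ℝ} (hb : 0 ≤ b) (h : (b - P) ^ 2 ≤ b ^ 2 * (b ^ 2 - 1)) :
    maxLeg b ≤ P := by
  have hsqrt : b - P ≤ √(b ^ 2 * (b ^ 2 - 1)) := Real.le_sqrt_of_sq_le h
  rw [Real.sqrt_mul (sq_nonneg b), Real.sqrt_sq hb] at hsqrt
  rw [maxLeg]
  linarith

lemma maxLeg_one : maxLeg 1 = 1 := by
  simp [maxLeg]

lemma maxLeg_strictAntiOn : StrictAntiOn maxLeg (Set.Ici 1) := by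
  intro b hb b' hb' hlt
  rw [Set.mem_Ici] at hb hb'
  have hsq : (b - maxLeg b) ^ 2 = b ^ 2 * (b ^ 2 - 1) := sq_sub_maxLeg hb
  have hsq' : (b' - maxLeg b') ^ 2 = b' ^ 2 * (b' ^ 2 - 1) := sq_sub_maxLeg hb'
  have hu : b - maxLeg b ≤ b ^ 2 := le_of_abs_le (abs_le_of_sq_le_sq (by nlinarith) (sq_nonneg b))
  have hu' : 0 ≤ b' - maxLeg b' := by rw [maxLeg, sub_sub_cancel]; positivity
  by_contra! hle
  have hd : (b' - maxLeg b') ^ 2 ≤ (b' - b + (b - maxLeg b)) ^ 2 := by gcongr; linarith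
  have hfactor : (b' - b) * ((b' + b) * (b' ^ 2 + b ^ 2 - 1)) ≤
      (b' - b) * (b' - b + 2 * (b - maxLeg b)) := by
    linear_combination hd + hsq - hsq'
  have hcube : b ^ 2 * b ≤ b' ^ 2 * b' := by gcongr
  have hcube' : b ^ 2 * b < b' ^ 2 * b := by gcongr
  nlinarith [hcube, hcube', le_of_mul_le_mul_left hfactor (sub_pos.2 hlt)]

-- `maxLeg b` is chosen so that the left side vanishes at `c = 1 / b`.
lemma maxLeg_identity {b c s : ℝ} (hb : 1 ≤ b) (hcs : c ^ 2 + s ^ 2 = 1) :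
    b ^ 2 * ((b * s) ^ 2 - (1 - maxLeg b * c) ^ 2) =
      (1 - b * c) * (b ^ 2 * (b ^ 2 - 1) + b * c * (b ^ 2 + maxLeg b ^ 2)) := by
  linear_combination b ^ 4 * hcs - b * c * sq_sub_maxLeg hb

lemma one_le_mul_add_maxLeg_mul {b c s : ℝ} (hb : 1 ≤ b) (hc : 0 ≤ c) (hs : 0 ≤ s)
    (hcs : c ^ 2 + s ^ 2 = 1) (hbc : b * c ≤ 1) : 1 ≤ b * s + maxLeg b * c := by
  have hb2 : 0 ≤ b ^ 2 - 1 := by nlinarith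
  have hnonneg : 0 ≤ b ^ 2 * ((b * s) ^ 2 - (1 - maxLeg b * c) ^ 2) := by
    rw [maxLeg_identity hb hcs]
    exact mul_nonneg (sub_nonneg.2 hbc) (by positivity)
  have hsq : (1 - maxLeg b * c) ^ 2 ≤ (b * s) ^ 2 :=
    sub_nonneg.1 (nonneg_of_mul_nonneg_right hnonneg (by positivity))
  linarith [le_of_abs_le (abs_le_of_sq_le_sq hsq (by positivity))]

lemma mul_eq_one_of_mul_add_maxLeg_mul_le_one {b c s : ℝ} (hb : 1 < b) (hc : 0 ≤ c) (hs : 0 ≤ s)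
    (hcs : c ^ 2 + s ^ 2 = 1) (hbc : b * c ≤ 1) (h : b * s + maxLeg b * c ≤ 1) : b * c = 1 := by
  have hb2 : 0 < b ^ 2 - 1 := by nlinarith
  have hsq : (b * s) ^ 2 ≤ (1 - maxLeg b * c) ^ 2 := by gcongr; linarith
  have hnonpos : (1 - b * c) * (b ^ 2 * (b ^ 2 - 1) + b * c * (b ^ 2 + maxLeg b ^ 2)) ≤ 0 := by
    rw [← maxLeg_identity hb.le hcs]
    exact mul_nonpos_of_nonneg_of_nonpos (sq_nonneg b) (sub_nonpos.2 hsq)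
  have hle : 1 - b * c ≤ 0 := by
    by_contra! hlt
    exact hnonpos.not_gt (by positivity)
  linarith

lemma leg_le_maxLeg {b c s p : ℝ} (hb : 1 ≤ b) (hc : 0 ≤ c) (hs : 0 ≤ s)
    (hcs : c ^ 2 + s ^ 2 = 1) (hbc : b * c ≤ 1) (hps : p * s ≤ 1) (h : b * s + p * c ≤ 1) :
    p ≤ maxLeg b := by
  obtain rfl | hc0 := hc.eq_or_lt
  · obtain rfl : s = 1 := by nlinarith
    obtain rfl : b = 1 := by linarith
    rw [maxLeg_one]
    linarith
  · have := one_le_mul_add_maxLeg_mul hb hc hs hcs hbc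
    exact le_of_mul_le_mul_right (by linarith) hc0

lemma eq_one_of_trapezoid {a c s l t : ℝ} (ha : 1 ≤ a) (hc : 0 ≤ c) (hs : 0 ≤ s)
    (hcs : c ^ 2 + s ^ 2 = 1) (ht : c * a + s * t ≤ 1) (hl : c * l + s * a ≤ 1)
    (hlt : a ≤ l + t) : a = 1 ∧ c * s = 0 := by
  have hc1 := le_one_of_sq_add_sq_eq_one hcs
  have hs1 : s ≤ 1 := le_one_of_sq_add_sq_eq_one (by linarith : s ^ 2 + c ^ 2 = 1)
  have hle : a * (1 + c * s) ≤ c + s := by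
    linear_combination c * ht + s * hl + c * s * hlt - a * hcs
  have hprod : c + s = 1 + c * s - (1 - c) * (1 - s) := by ring
  have hprod0 : 0 ≤ (1 - c) * (1 - s) := mul_nonneg (sub_nonneg.2 hc1) (sub_nonneg.2 hs1)
  obtain rfl : a = 1 := by nlinarith [mul_nonneg hc hs]
  refine ⟨rfl, ?_⟩
  obtain h | h := mul_eq_zero.1 (le_antisymm (by linarith) hprod0)
  · obtain rfl : c = 1 := by linarith
    obtain rfl : s = 0 := by nlinarith
    exact mul_zero _
  · obtain rfl : s = 1 := by linarith
    obtain rfl : c = 0 := by nlinarith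
    exact zero_mul _

/-! ### Estimates for the edge length `√φ` -/

lemma sqrtPhi_pos : 0 < sqrtPhi := Real.sqrt_pos.2 Real.goldenRatio_pos

lemma sqrtPhi_pow_four : sqrtPhi ^ 4 = sqrtPhi ^ 2 + 1 := by
  have hsq : sqrtPhi ^ 2 = Real.goldenRatio := Real.sq_sqrt Real.goldenRatio_pos.le
  rw [show sqrtPhi ^ 4 = (sqrtPhi ^ 2) ^ 2 by ring, hsq, Real.goldenRatio_sq]

lemma lt_sqrtPhi : 1.27 < sqrtPhi := by
  by_contra! h
  have hsq : sqrtPhi ^ 2 ≤ 1.27 ^ 2 := pow_le_pow_left₀ sqrtPhi_pos.le h 2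
  nlinarith [sqrtPhi_pow_four]

lemma sqrtPhi_lt : sqrtPhi < 1.28 := by
  by_contra! h
  have hsq : 1.28 ^ 2 ≤ sqrtPhi ^ 2 := pow_le_pow_left₀ (by norm_num) h 2
  nlinarith [sqrtPhi_pow_four]

lemma maxLeg_sqrtPhi : maxLeg sqrtPhi = sqrtPhi - 1 := by
  have h : sqrtPhi ^ 2 * (sqrtPhi ^ 2 - 1) = 1 := by linear_combination sqrtPhi_pow_four
  have hroot : sqrtPhi * √(sqrtPhi ^ 2 - 1) = 1 := by
    nth_rw 1 [← Real.sqrt_sq sqrtPhi_pos.le]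
    rw [← Real.sqrt_mul (sq_nonneg _), h, Real.sqrt_one]
  rw [maxLeg, hroot]

lemma maxLeg_le_sub_one {a : ℝ} (ha : sqrtPhi ≤ a) : maxLeg a ≤ a - 1 := by
  have hr := lt_sqrtPhi
  calc maxLeg a ≤ maxLeg sqrtPhi :=
        maxLeg_strictAntiOn.antitoneOn (Set.mem_Ici.2 (by linarith))
          (Set.mem_Ici.2 (by linarith)) ha
    _ = sqrtPhi - 1 := maxLeg_sqrtPhi
    _ ≤ a - 1 := by linarith

lemma one_le_sqrtPhi_sq_mul {c s : ℝ} (hc : 0 ≤ c) (hs : 0 ≤ s) (hcs : c ^ 2 + s ^ 2 = 1)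
    (h : sqrtPhi * s ≤ 1) : 1 ≤ sqrtPhi ^ 2 * c := by
  have hr := sqrtPhi_pos
  have hid : (sqrtPhi ^ 2 * c) ^ 2 = 1 + sqrtPhi ^ 2 * (1 - (sqrtPhi * s) ^ 2) := by
    linear_combination sqrtPhi ^ 4 * hcs + sqrtPhi_pow_four
  have hsq : (sqrtPhi * s) ^ 2 ≤ 1 := pow_le_one₀ (by positivity) h
  have h1 : 1 ^ 2 ≤ (sqrtPhi ^ 2 * c) ^ 2 := by
    rw [hid]
    nlinarith [sq_nonneg sqrtPhi]
  exact (pow_le_pow_iff_left₀ zero_le_one (by positivity) two_ne_zero).1 h1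

lemma left_height_le {c s l : ℝ} (hc : 0 ≤ c) (hle : c ≤ s) (hcs : c ^ 2 + s ^ 2 = 1)
    (hl : 0 ≤ l) (h : sqrtPhi * s + l * c ≤ 1) : l ≤ 1 / 6 := by
  have hr := lt_sqrtPhi
  have hr' := sqrtPhi_lt
  have hs : 0 ≤ s := hc.trans hle
  have hrc := one_le_sqrtPhi_sq_mul hc hs hcs (by nlinarith)
  have hc6 : 3 / 5 ≤ c := by nlinarith
  have hs8 : s ≤ 4 / 5 := by nlinarith
  have hsum : 7 / 5 ≤ c + s := by nlinarith
  have hchebyshev : (sqrtPhi + l) * (c + s) ≤ 2 * (sqrtPhi * s + l * c) := by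
    have hlr : l ≤ sqrtPhi := by nlinarith
    linear_combination mul_nonneg (sub_nonneg.2 hlr) (sub_nonneg.2 hle)
  nlinarith [hchebyshev]

lemma right_height_le {c s l t : ℝ} (hc : 0 ≤ c) (hs : 0 < s) (hcs : c ^ 2 + s ^ 2 = 1)
    (hl : 0 ≤ l) (h1 : sqrtPhi * s + l * c ≤ 1) (h2 : sqrtPhi * c + t * s ≤ 1) :
    t + l / 2 ≤ sqrtPhi - 1 := by
  have hr := lt_sqrtPhi
  have hr' := sqrtPhi_lt
  have hr0 := sqrtPhi_pos
  have h4 := sqrtPhi_pow_four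
  have hrs : sqrtPhi * s ≤ 1 := by nlinarith
  have hrc : 1 ≤ sqrtPhi ^ 2 * c := one_le_sqrtPhi_sq_mul hc hs.le hcs hrs
  have hc0 : 0 < c := pos_of_mul_pos_right (by linarith) (sq_nonneg sqrtPhi)
  set r := sqrtPhi
  have hhalf : 2 * ((r - 1) * c + r * s / 2) ≤ 1 + r * s := by
    nlinarith [le_one_of_sq_add_sq_eq_one hcs]
  have hprod : ((r - 1) * c + r * s / 2) * (r ^ 2 * c + 1) ≤ c * (1 + r * s) * r ^ 2 :=
    have : 0 ≤ (r - 1) * c + r * s / 2 :=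
      add_nonneg (mul_nonneg (by linarith) hc) (by positivity)
    calc ((r - 1) * c + r * s / 2) * (r ^ 2 * c + 1)
        ≤ ((r - 1) * c + r * s / 2) * (2 * (r ^ 2 * c)) := by gcongr; linarith
      _ = 2 * ((r - 1) * c + r * s / 2) * (r ^ 2 * c) := by ring
      _ ≤ (1 + r * s) * (r ^ 2 * c) := by gcongr
      _ = c * (1 + r * s) * r ^ 2 := by ring
  have hid : (1 - r * s) * (1 + r * s) * r ^ 2 = (r ^ 2 * c - 1) * (r ^ 2 * c + 1) := by
    linear_combination -r ^ 4 * hcs - h4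
  have hkey : ((r - 1) * c + r * s / 2) * (1 - r * s) ≤ c * (r ^ 2 * c - 1) := by
    refine le_of_mul_le_mul_right ?_ (by positivity : 0 < r ^ 2 * c + 1)
    linear_combination mul_le_mul_of_nonneg_right hprod (sub_nonneg.2 hrs) + c * hid
  refine le_of_mul_le_mul_left ?_ (by positivity : 0 < r * c * s)
  linear_combination r * c * h2 + r * s / 2 * h1 + hkey

lemma maxLeg_sqrtPhi_sub_le {l : ℝ} (hl : 0 ≤ l) (hl' : l ≤ 1 / 6) :
    maxLeg (sqrtPhi - l) ≤ sqrtPhi - 1 + 2 * l := by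
  have hr := lt_sqrtPhi
  have hr' := sqrtPhi_lt
  set r := sqrtPhi
  have hid : (r - l) ^ 2 * ((r - l) ^ 2 - 1) - (r - l - (r - 1 + 2 * l)) ^ 2 =
      l * ((6 + 2 * r - 4 * r ^ 3) + l * (6 * r ^ 2 - 10) - 4 * r * l ^ 2 + l ^ 3) := by
    linear_combination sqrtPhi_pow_four
  have hconst : r * (6 + 2 * r - 4 * r ^ 3) = 2 * (r - 1) * (2 - r) := by
    linear_combination -4 * sqrtPhi_pow_four
  have hpoly : 0 ≤ (6 + 2 * r - 4 * r ^ 3) + l * (6 * r ^ 2 - 10) - 4 * r * l ^ 2 + l ^ 3 := by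
    have : 0.3 ≤ 6 + 2 * r - 4 * r ^ 3 := by nlinarith [hconst]
    have : l * (10 - 6 * r ^ 2) ≤ 1 / 6 * (10 - 6 * 1.27 ^ 2) := by
      gcongr
      nlinarith
    have : r * l ^ 2 ≤ 1.28 * (1 / 6) ^ 2 := by gcongr
    have : 0 ≤ l ^ 3 := by positivity
    linarith
  exact maxLeg_le (by linarith) (by nlinarith [mul_nonneg hl hpoly])

lemma maxLeg_one_add_le {l : ℝ} (hl : 0 ≤ l) (hl' : l ≤ 1 / 6) :
    maxLeg (1 + l / 2) ≤ 1 - 2.1 * l := by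
  refine maxLeg_le (by linarith) ?_
  nlinarith [mul_nonneg hl hl, mul_nonneg (mul_nonneg hl hl) hl]

lemma eq_of_le_maxLeg {a l t p : ℝ} (ha : sqrtPhi ≤ a) (hl : 0 ≤ l) (hl' : l ≤ 1 / 6)
    (ht : t + l / 2 ≤ sqrtPhi - 1) (hp : p ≤ maxLeg (a - l)) (hp' : a - p ≤ maxLeg (a - t)) :
    a = sqrtPhi ∧ l = 0 ∧ t = sqrtPhi - 1 ∧ p = sqrtPhi - 1 := by
  have hr := lt_sqrtPhi
  have hanti := maxLeg_strictAntiOn.antitoneOn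
  have h1 : maxLeg (a - l) ≤ sqrtPhi - 1 + 2 * l :=
    (hanti (Set.mem_Ici.2 (by linarith)) (Set.mem_Ici.2 (by linarith)) (by linarith)).trans
      (maxLeg_sqrtPhi_sub_le hl hl')
  have h2 : maxLeg (a - t) ≤ 1 - 2.1 * l :=
    (hanti (Set.mem_Ici.2 (by linarith)) (Set.mem_Ici.2 (by linarith)) (by linarith)).trans
      (maxLeg_one_add_le hl hl')
  obtain rfl : l = 0 := by linarith
  obtain rfl : a = sqrtPhi := by linarith
  have hat : sqrtPhi - t ≤ 1 := by
    refine (maxLeg_strictAntiOn.le_iff_ge (Set.mem_Ici.2 le_rfl) (Set.mem_Ici.2 ?_)).1 ?_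
    · linarith
    · rw [maxLeg_one]; linarith
  exact ⟨rfl, rfl, by linarith, by linarith⟩

/-! ### Squares in coordinates -/

lemma Plane.set_subset {A B : Set Plane} (h : ∀ x y : ℝ, !₂[x, y] ∈ A → !₂[x, y] ∈ B) :
    A ⊆ B := fun z => by
  have hz : z = !₂[z 0, z 1] := by ext i; fin_cases i <;> rfl
  rw [hz]
  exact h _ _

lemma Plane.set_ext {A B : Set Plane} (h : ∀ x y : ℝ, !₂[x, y] ∈ A ↔ !₂[x, y] ∈ B) : A = B :=
  (Plane.set_subset fun x y => (h x y).1).antisymm (Plane.set_subset fun x y => (h x y).2)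

lemma Plane.inner_eq (u v : Plane) : inner ℝ u v = u 0 * v 0 + u 1 * v 1 := by
  simp [PiLp.inner_apply, Fin.sum_univ_two, mul_comm]

lemma mem_stdSquare {a x y : ℝ} : !₂[x, y] ∈ stdSquare a ↔ x ∈ Set.Icc 0 a ∧ y ∈ Set.Icc 0 a := by
  simp [stdSquare, Fin.forall_fin_two]

/-- The square of edge length `a` with edge directions `(c, s)` and `(-s, c)` whose lowest vertex
with respect to these directions has coordinates `e` and `f`. -/
def tiltedSquare (a c s e f : ℝ) : Set Plane :=
  {x | c * x 0 + s * x 1 ∈ Set.Icc e (e + a) ∧ -s * x 0 + c * x 1 ∈ Set.Icc f (f + a)}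

lemma mem_tiltedSquare {a c s e f x y : ℝ} : !₂[x, y] ∈ tiltedSquare a c s e f ↔
    c * x + s * y ∈ Set.Icc e (e + a) ∧ -s * x + c * y ∈ Set.Icc f (f + a) := by
  simp [tiltedSquare]

lemma tiltedSquare_quarter_turn (a c s e f : ℝ) :
    tiltedSquare a c s e f = tiltedSquare a s (-c) (-f - a) e := by
  refine Plane.set_ext fun x y => ?_
  simp only [mem_tiltedSquare, Set.mem_Icc]
  grind

lemma exists_tiltedSquare_eq_of_nonneg {c s : ℝ} (a e f : ℝ) (h : c ^ 2 + s ^ 2 = 1) :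
    ∃ c' s' e' f', 0 ≤ c' ∧ 0 ≤ s' ∧ c' ^ 2 + s' ^ 2 = 1 ∧
      tiltedSquare a c s e f = tiltedSquare a c' s' e' f' := by
  obtain hc | hc := le_total 0 c <;> obtain hs | hs := le_total 0 s
  · exact ⟨c, s, e, f, hc, hs, h, rfl⟩
  · refine ⟨-s, c, f, -e - a, neg_nonneg.2 hs, hc, by linarith, ?_⟩
    rw [tiltedSquare_quarter_turn a (-s), neg_neg, neg_sub, sub_neg_eq_add, add_sub_cancel_left]
  · exact ⟨s, -c, -f - a, e, hs, neg_nonneg.2 hc, by linarith, tiltedSquare_quarter_turn ..⟩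
  · refine ⟨-c, -s, -e - a, -f - a, neg_nonneg.2 hc, neg_nonneg.2 hs, by linarith, ?_⟩
    rw [tiltedSquare_quarter_turn, tiltedSquare_quarter_turn]

lemma IsSquareOfEdge.exists_orthonormal_frame {a : ℝ} {Q : Set Plane} (hQ : IsSquareOfEdge a Q) :
    ∃ (b : Fin 2 → Plane) (k : Fin 2 → ℝ), Orthonormal ℝ b ∧
      Q = {x | ∀ i, inner ℝ (b i) x + k i ∈ Set.Icc 0 a} := by
  obtain ⟨-, g, rfl⟩ := hQ
  let M := g.symm.toRealAffineIsometryEquiv.linearIsometryEquiv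
  refine ⟨fun i => M.symm (EuclideanSpace.single i 1), fun i => g.symm 0 i,
    (EuclideanSpace.orthonormal_single).comp_linearIsometryEquiv M.symm, ?_⟩
  ext x
  have hx : g.symm x = M x + g.symm 0 := by
    simpa using g.symm.toRealAffineIsometryEquiv.map_vadd 0 x
  have hinner (i : Fin 2) :
      inner ℝ (M.symm (EuclideanSpace.single i 1)) x = M x i := by
    rw [← M.inner_map_map, M.apply_symm_apply, EuclideanSpace.inner_single_left]
    simp
  rw [← g.preimage_symm]
  simp [stdSquare, hx, hinner]

lemma Plane.eq_or_eq_neg_of_orthonormal {b : Fin 2 → Plane} (hb : Orthonormal ℝ b) :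
    b 0 0 ^ 2 + b 0 1 ^ 2 = 1 ∧
      (b 1 = !₂[-b 0 1, b 0 0] ∨ b 1 = !₂[b 0 1, -b 0 0]) := by
  have hinner (i j : Fin 2) : b i 0 * b j 0 + b i 1 * b j 1 = if i = j then 1 else 0 := by
    rw [← orthonormal_iff_ite.1 hb i j, Plane.inner_eq]
  have h00 : b 0 0 * b 0 0 + b 0 1 * b 0 1 = 1 := hinner 0 0
  have h01 : b 0 0 * b 1 0 + b 0 1 * b 1 1 = 0 := hinner 0 1
  have h11 : b 1 0 * b 1 0 + b 1 1 * b 1 1 = 1 := hinner 1 1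
  have hdet : (b 0 0 * b 1 1 - b 0 1 * b 1 0) * (b 0 0 * b 1 1 - b 0 1 * b 1 0) = 1 := by
    linear_combination h00 * (b 1 0 ^ 2 + b 1 1 ^ 2) + h11 -
      (b 0 0 * b 1 0 + b 0 1 * b 1 1) * h01
  refine ⟨by linarith, (mul_self_eq_one_iff.1 hdet).imp (fun hd => ?_) fun hd => ?_⟩ <;>
    ext i <;> fin_cases i <;> dsimp
  · linear_combination b 0 0 * h01 - b 0 1 * hd - b 1 0 * h00
  · linear_combination b 0 1 * h01 + b 0 0 * hd - b 1 1 * h00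
  · linear_combination b 0 0 * h01 - b 0 1 * hd - b 1 0 * h00
  · linear_combination b 0 1 * h01 + b 0 0 * hd - b 1 1 * h00

lemma IsSquareOfEdge.exists_tiltedSquare {a : ℝ} {Q : Set Plane} (hQ : IsSquareOfEdge a Q) :
    ∃ c s e f, 0 ≤ c ∧ 0 ≤ s ∧ c ^ 2 + s ^ 2 = 1 ∧ Q = tiltedSquare a c s e f := by
  obtain ⟨b, k, hb, rfl⟩ := hQ.exists_orthonormal_frame
  obtain ⟨hsq, hb1⟩ := Plane.eq_or_eq_neg_of_orthonormal hb
  suffices ∃ f, {x | ∀ i, inner ℝ (b i) x + k i ∈ Set.Icc 0 a} =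
      tiltedSquare a (b 0 0) (b 0 1) (-k 0) f by
    obtain ⟨f, hf⟩ := this
    rw [hf]
    exact exists_tiltedSquare_eq_of_nonneg a _ _ hsq
  obtain hb1 | hb1 := hb1
  · refine ⟨-k 1, Plane.set_ext fun x y => ?_⟩
    simp only [mem_tiltedSquare, Set.mem_ofPred_eq, Fin.forall_fin_two, hb1, Plane.inner_eq,
      Set.mem_Icc, PiLp.toLp_apply, Matrix.cons_val_zero, Matrix.cons_val_one]
    grind
  · refine ⟨k 1 - a, Plane.set_ext fun x y => ?_⟩
    simp only [mem_tiltedSquare, Set.mem_ofPred_eq, Fin.forall_fin_two, hb1, Plane.inner_eq,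
      Set.mem_Icc, PiLp.toLp_apply, Matrix.cons_val_zero, Matrix.cons_val_one]
    grind

lemma isClosed_stdSquare (a : ℝ) : IsClosed (stdSquare a) := by
  have : stdSquare a = ⋂ i, (fun x : Plane => x i) ⁻¹' Set.Icc 0 a := by
    ext x; simp [stdSquare]
  rw [this]
  exact isClosed_iInter fun i => isClosed_Icc.preimage (by fun_prop)

lemma IsSquareOfEdge.isClosed {a : ℝ} {Q : Set Plane} (hQ : IsSquareOfEdge a Q) : IsClosed Q := by
  obtain ⟨-, g, rfl⟩ := hQ
  exact g.toHomeomorph.isClosedMap _ (isClosed_stdSquare a)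

lemma IsSquareOfEdge.image {a : ℝ} {Q : Set Plane} (hQ : IsSquareOfEdge a Q) (g : Plane ≃ᵢ Plane) :
    IsSquareOfEdge a (g '' Q) := by
  obtain ⟨ha, k, rfl⟩ := hQ
  exact ⟨ha, k.trans g, by rw [Set.image_image]; rfl⟩

lemma isSquareOfEdge_stdSquare {a : ℝ} (ha : 0 < a) : IsSquareOfEdge a (stdSquare a) :=
  ⟨ha, IsometryEquiv.refl _, (Set.image_id _).symm⟩

lemma IsSquareOfEdge.dist_sq_le {a x y x' y' : ℝ} {Q : Set Plane} (hQ : IsSquareOfEdge a Q)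
    (h : !₂[x, y] ∈ Q) (h' : !₂[x', y'] ∈ Q) : (x' - x) ^ 2 + (y' - y) ^ 2 ≤ 2 * a ^ 2 := by
  obtain ⟨c, s, e, f, -, -, hcs, rfl⟩ := hQ.exists_tiltedSquare
  simp only [mem_tiltedSquare, Set.mem_Icc] at h h'
  have hu : (c * (x' - x) + s * (y' - y)) ^ 2 ≤ a ^ 2 := sq_le_sq' (by linarith) (by linarith)
  have hv : (-s * (x' - x) + c * (y' - y)) ^ 2 ≤ a ^ 2 := sq_le_sq' (by linarith) (by linarith)
  linear_combination hu + hv - ((x' - x) ^ 2 + (y' - y) ^ 2) * hcs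

lemma mem_frontier_stdSquare {a : ℝ} {x : Plane} (hx : x ∈ stdSquare a) {i : Fin 2}
    (hi : x i = 0 ∨ x i = a) : x ∈ frontier (stdSquare a) := by
  rw [(isClosed_stdSquare a).frontier_eq]
  refine ⟨hx, fun hx_int => ?_⟩
  have hopen : IsOpenMap (fun y : Plane => y i) :=
    (EuclideanSpace.proj i : Plane →L[ℝ] ℝ).isOpenMap fun r => ⟨EuclideanSpace.single i r, by simp⟩
  have hsub : stdSquare a ⊆ (fun y : Plane => y i) ⁻¹' Set.Icc 0 a := fun y hy => hy i
  have hmem : x i ∈ Set.Ioo 0 a := by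
    rw [← interior_Icc]
    have := interior_mono hsub hx_int
    rwa [← hopen.preimage_interior_eq_interior_preimage (by fun_prop)] at this
  obtain hi | hi := hi
  · exact hmem.1.ne' hi
  · exact hmem.2.ne hi

/-! ### Symmetries -/

/-- The reflection of the plane in the line `x = y`. -/
noncomputable def diagReflection : Plane ≃ᵢ Plane :=
  (LinearIsometryEquiv.piLpCongrLeft 2 ℝ ℝ (Equiv.swap 0 1)).toIsometryEquiv

/-- The reflection of the plane in the vertical line through the centre of `stdSquare a`. -/
def mirror (a : ℝ) : Plane ≃ᵢ Plane where
  toFun x := !₂[a - x 0, x 1]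
  invFun x := !₂[a - x 0, x 1]
  left_inv x := by ext i; fin_cases i <;> simp
  right_inv x := by ext i; fin_cases i <;> simp
  isometry_toFun := Isometry.of_dist_eq fun x y => by
    simp [EuclideanSpace.dist_eq, Fin.sum_univ_two, Real.dist_eq, sub_sq_comm (y 0)]

lemma mem_image_diagReflection {x y : ℝ} {A : Set Plane} :
    !₂[x, y] ∈ diagReflection '' A ↔ !₂[y, x] ∈ A := by
  rw [← IsometryEquiv.preimage_symm, Set.mem_preimage]
  suffices diagReflection.symm !₂[x, y] = !₂[y, x] by rw [this]
  ext i
  fin_cases i <;> rfl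

lemma mem_image_mirror {a x y : ℝ} {A : Set Plane} :
    !₂[x, y] ∈ mirror a '' A ↔ !₂[a - x, y] ∈ A := by
  rw [← IsometryEquiv.preimage_symm]
  rfl

lemma diagReflection_image_stdSquare (a : ℝ) : diagReflection '' stdSquare a = stdSquare a :=
  Plane.set_ext fun x y => by
    rw [mem_image_diagReflection, mem_stdSquare, mem_stdSquare, and_comm]

lemma mirror_image_stdSquare (a : ℝ) : mirror a '' stdSquare a = stdSquare a :=
  Plane.set_ext fun x y => by
    simp only [mem_image_mirror, mem_stdSquare, Set.mem_Icc]
    grind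

/-- `T` is a translate of `S`. -/
def IsTranslate (T S : Set Plane) : Prop := ∃ v : Plane, T = (fun x => x + v) '' S

lemma IsTranslate.image {T S : Set Plane} (h : IsTranslate T S) (g : Plane ≃ᵢ Plane) :
    IsTranslate (g '' T) (g '' S) := by
  obtain ⟨v, rfl⟩ := h
  refine ⟨g v - g 0, ?_⟩
  rw [Set.image_image, Set.image_image]
  refine Set.image_congr fun x _ => ?_
  let h := g.toRealAffineIsometryEquiv
  have hxv : g (x + v) = h.linearIsometryEquiv x + g v := h.map_vadd v x
  have hx : g (x + 0) = h.linearIsometryEquiv x + g 0 := h.map_vadd 0 x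
  rw [add_zero] at hx
  rw [hxv, hx]
  abel

lemma IsTranslate.of_image {T S : Set Plane} {g : Plane ≃ᵢ Plane}
    (h : IsTranslate (g '' T) (g '' S)) : IsTranslate T S := by
  simpa [Set.image_image] using h.image g.symm

lemma isTranslate_stdSquare_of_mul_eq_zero {a c s e f : ℝ} (hc : 0 ≤ c) (hs : 0 ≤ s)
    (hcs : c ^ 2 + s ^ 2 = 1) (h : c * s = 0) :
    IsTranslate (tiltedSquare a c s e f) (stdSquare a) := by
  have key (v w : ℝ) (hvw : ∀ x y : ℝ, !₂[x, y] ∈ tiltedSquare a c s e f ↔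
      x - v ∈ Set.Icc 0 a ∧ y - w ∈ Set.Icc 0 a) :
      IsTranslate (tiltedSquare a c s e f) (stdSquare a) := by
    refine ⟨!₂[v, w], Plane.set_ext fun x y => ?_⟩
    rw [hvw, Set.image_add_right, Set.mem_preimage]
    simp [stdSquare, Fin.forall_fin_two, sub_eq_add_neg]
  simp only [mem_tiltedSquare, Set.mem_Icc] at key
  obtain rfl | rfl := mul_eq_zero.1 h
  · obtain rfl : s = 1 := by nlinarith
    exact key (-f - a) e (by grind)
  · obtain rfl : c = 1 := by nlinarith
    exact key e f (by grind)

/-! ### Configurations of points in a unit square -/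

namespace IsSquareOfEdge

variable {Q : Set Plane} {x y x' y' d l t : ℝ}

lemma abs_sub_le_maxLeg (hQ : IsSquareOfEdge 1 Q) (h : !₂[x, y] ∈ Q) (hx : !₂[x', y] ∈ Q)
    (hy : !₂[x, y'] ∈ Q) (hb : 1 ≤ |x' - x|) : |y' - y| ≤ maxLeg |x' - x| := by
  obtain ⟨c, s, e, f, hc, hs, hcs, rfl⟩ := hQ.exists_tiltedSquare
  have hsc : s ^ 2 + c ^ 2 = 1 := by linarith
  simp only [mem_tiltedSquare, Set.mem_Icc] at h hx hy
  obtain ⟨hdx, -⟩ | ⟨hdx, -⟩ := abs_cases (x' - x) <;>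
    obtain ⟨hdy, -⟩ | ⟨hdy, -⟩ := abs_cases (y' - y) <;> rw [hdx] at hb ⊢ <;> rw [hdy]
  · exact leg_le_maxLeg hb hc hs hcs (by linarith) (by linarith) (by linarith)
  · exact leg_le_maxLeg hb hs hc hsc (by linarith) (by linarith) (by linarith)
  · exact leg_le_maxLeg hb hs hc hsc (by linarith) (by linarith) (by linarith)
  · exact leg_le_maxLeg hb hc hs hcs (by linarith) (by linarith) (by linarith)

lemma abs_sub_le_maxLeg_swap (hQ : IsSquareOfEdge 1 Q) (h : !₂[x, y] ∈ Q) (hx : !₂[x', y] ∈ Q)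
    (hy : !₂[x, y'] ∈ Q) (hb : 1 ≤ |y' - y|) : |x' - x| ≤ maxLeg |y' - y| :=
  (hQ.image diagReflection).abs_sub_le_maxLeg (mem_image_diagReflection.2 h)
    (mem_image_diagReflection.2 hy) (mem_image_diagReflection.2 hx) hb

lemma abs_sub_le_of_sqrtPhi_le (hQ : IsSquareOfEdge 1 Q) (h : !₂[x, y] ∈ Q) (hx : !₂[x', y] ∈ Q)
    (hb : sqrtPhi ≤ |x' - x|) {z : ℝ} (hz : z = x ∨ z = x') (hy : !₂[z, y'] ∈ Q) :
    |y' - y| ≤ |x' - x| - 1 := by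
  have hone : 1 ≤ |x' - x| := by linarith [lt_sqrtPhi]
  refine le_trans ?_ (maxLeg_le_sub_one hb)
  obtain rfl | rfl := hz
  · exact hQ.abs_sub_le_maxLeg h hx hy hone
  · rw [abs_sub_comm] at hone
    rw [abs_sub_comm z]
    exact hQ.abs_sub_le_maxLeg hx h hy hone

lemma eq_one_and_isTranslate_of_trapezoid (hQ : IsSquareOfEdge 1 Q) (hd : 1 ≤ d)
    (h : !₂[x, y] ∈ Q) (hx : !₂[x + d, y] ∈ Q) (hl : !₂[x, y + l] ∈ Q)
    (ht : !₂[x + d, y + t] ∈ Q) (hlt : d ≤ |l + t|) :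
    d = 1 ∧ IsTranslate Q (stdSquare 1) := by
  obtain ⟨c, s, e, f, hc, hs, hcs, rfl⟩ := hQ.exists_tiltedSquare
  simp only [mem_tiltedSquare, Set.mem_Icc] at h hx hl ht
  suffices d = 1 ∧ c * s = 0 from
    this.imp_right (isTranslate_stdSquare_of_mul_eq_zero hc hs hcs)
  obtain hlt | hlt := le_abs.1 hlt
  · exact eq_one_of_trapezoid (l := l) (t := t) hd hc hs hcs
      (by linarith) (by linarith) hlt
  · exact eq_one_of_trapezoid (l := -t) (t := -l) hd hc hs hcs
      (by linarith) (by linarith) (by linarith)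

lemma eq_one_and_isTranslate_of_diagonal (hQ : IsSquareOfEdge 1 Q) (hd : 1 ≤ d)
    (h : !₂[x, y] ∈ Q ∧ !₂[x + d, y + d] ∈ Q ∨ !₂[x + d, y] ∈ Q ∧ !₂[x, y + d] ∈ Q) :
    d = 1 ∧ IsTranslate Q (stdSquare 1) := by
  obtain ⟨c, s, e, f, hc, hs, hcs, rfl⟩ := hQ.exists_tiltedSquare
  simp only [mem_tiltedSquare, Set.mem_Icc] at h
  have hsum : c * d + s * d ≤ 1 := by obtain h | h := h <;> linarith
  suffices d = 1 ∧ c * s = 0 from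
    this.imp_right (isTranslate_stdSquare_of_mul_eq_zero hc hs hcs)
  exact eq_one_of_trapezoid (l := 0) (t := d) hd hc hs hcs hsum (by nlinarith) (by linarith)

lemma exists_image_eq {a : ℝ} (hQ : IsSquareOfEdge a Q) :
    ∃ g : Plane ≃ᵢ Plane, g '' Q = stdSquare a := by
  obtain ⟨-, g, rfl⟩ := hQ
  exact ⟨g.symm, by simp [Set.image_image]⟩

end IsSquareOfEdge

/-! ### Boundary covers and the case of two squares -/

lemma exists_mem_inter_of_continuousOn {X : Type*} [TopologicalSpace X] {A B : Set X}
    (hA : IsClosed A) (hB : IsClosed B) {γ : ℝ → X} {u v : ℝ} (hγ : ContinuousOn γ (Set.Icc u v))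
    (huv : u ≤ v) (hu : γ u ∈ A) (hv : γ v ∈ B) (hcov : ∀ z ∈ Set.Icc u v, γ z ∈ A ∪ B) :
    ∃ z ∈ Set.Icc u v, γ z ∈ A ∧ γ z ∈ B := by
  obtain ⟨_, ⟨z, hz, rfl⟩, hzA, hzB⟩ :=
    isPreconnected_closed_iff.1 (isPreconnected_Icc.image γ hγ) A B hA hB
      (Set.image_subset_iff.2 hcov) ⟨γ u, Set.mem_image_of_mem γ (Set.left_mem_Icc.2 huv), hu⟩
      ⟨γ v, Set.mem_image_of_mem γ (Set.right_mem_Icc.2 huv), hv⟩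
  exact ⟨z, hz, hzA, hzB⟩

/-- The unit squares `F i` cover the boundary of `S`. -/
structure BoundaryCover {ι : Type*} (F : ι → Set Plane) (S : Set Plane) : Prop where
  isSquare : ∀ i, IsSquareOfEdge 1 (F i)
  frontier_subset : frontier S ⊆ ⋃ i, F i

namespace BoundaryCover

variable {ι κ : Type*} {F : ι → Set Plane} {S : Set Plane} {a : ℝ}

lemma image (h : BoundaryCover F S) (g : Plane ≃ᵢ Plane) :
    BoundaryCover (fun i => g '' F i) (g '' S) where
  isSquare i := (h.isSquare i).image g
  frontier_subset := by
    rw [← Set.image_iUnion]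
    exact (g.toHomeomorph.image_frontier S).symm.subset.trans (Set.image_mono h.frontier_subset)

lemma comp_equiv (h : BoundaryCover F S) (σ : κ ≃ ι) : BoundaryCover (F ∘ σ) S where
  isSquare i := h.isSquare (σ i)
  frontier_subset := h.frontier_subset.trans (σ.surjective.iUnion_comp F).symm.subset

lemma exists_mem (h : BoundaryCover F (stdSquare a)) {x y : ℝ} (hx : x ∈ Set.Icc 0 a)
    (hy : y ∈ Set.Icc 0 a) (hxy : (x = 0 ∨ x = a) ∨ y = 0 ∨ y = a) : ∃ i, !₂[x, y] ∈ F i := by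
  refine Set.mem_iUnion.1 (h.frontier_subset ?_)
  obtain hx' | hy' := hxy
  · exact mem_frontier_stdSquare (i := 0) (mem_stdSquare.2 ⟨hx, hy⟩) hx'
  · exact mem_frontier_stdSquare (i := 1) (mem_stdSquare.2 ⟨hx, hy⟩) hy'

lemma eq_one_and_exists_isTranslate_of_opposite_edges {F : Fin 2 → Set Plane}
    (h : BoundaryCover F (stdSquare a)) (ha : 1 ≤ a) {i j : Fin 2} (hij : i ≠ j)
    (h00 : !₂[0, 0] ∈ F i) (h10 : !₂[a, 0] ∈ F i) (h01 : !₂[0, a] ∈ F j) (h11 : !₂[a, a] ∈ F j) :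
    a = 1 ∧ ∃ i, IsTranslate (F i) (stdSquare 1) := by
  have ha0 : 0 ≤ a := by linarith
  have hcov {x y : ℝ} (hx : x = 0 ∨ x = a) (hy : y ∈ Set.Icc 0 a) : !₂[x, y] ∈ F i ∪ F j := by
    obtain ⟨k, hk⟩ := h.exists_mem (by grind) hy (.inl hx)
    obtain rfl | rfl : k = i ∨ k = j := by omega
    exacts [.inl hk, .inr hk]
  obtain ⟨l, -, hli, hlj⟩ := exists_mem_inter_of_continuousOn (γ := fun y => !₂[0, y])
    (h.isSquare i).isClosed (h.isSquare j).isClosed (by fun_prop) ha0 h00 h01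
    fun _ => hcov (.inl rfl)
  obtain ⟨t, -, hti, htj⟩ := exists_mem_inter_of_continuousOn (γ := fun y => !₂[a, y])
    (h.isSquare i).isClosed (h.isSquare j).isClosed (by fun_prop) ha0 h10 h11
    fun _ => hcov (.inr rfl)
  obtain hlt | hlt := le_total a (l + t)
  · exact ((h.isSquare i).eq_one_and_isTranslate_of_trapezoid ha h00 (by simpa using h10)
      (by simpa using hli) (by simpa using hti) (le_abs.2 (.inl hlt))).imp_right fun hi => ⟨i, hi⟩
  · exact ((h.isSquare j).eq_one_and_isTranslate_of_trapezoid (l := l - a) (t := t - a) ha h01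
      (by simpa using h11) (by simpa using hlj) (by simpa using htj)
      (le_abs.2 (.inr (by linarith)))).imp_right fun hj => ⟨j, hj⟩

lemma eq_one_and_exists_isTranslate_of_stdSquare {F : Fin 2 → Set Plane}
    (h : BoundaryCover F (stdSquare a)) (ha : 1 ≤ a) :
    a = 1 ∧ ∃ i, IsTranslate (F i) (stdSquare 1) := by
  have h0 : (0 : ℝ) ∈ Set.Icc 0 a := Set.left_mem_Icc.2 (by linarith)
  have h1 : a ∈ Set.Icc 0 a := Set.right_mem_Icc.2 (by linarith)
  obtain ⟨i, h00⟩ := h.exists_mem h0 h0 (by simp)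
  obtain ⟨j, h10⟩ := h.exists_mem h1 h0 (by simp)
  obtain ⟨k, h01⟩ := h.exists_mem h0 h1 (by simp)
  obtain ⟨m, h11⟩ := h.exists_mem h1 h1 (by simp)
  by_cases hdiag : i = m ∨ j = k
  · obtain rfl | rfl := hdiag
    · exact ((h.isSquare i).eq_one_and_isTranslate_of_diagonal (x := 0) (y := 0) ha
        (.inl (by simpa using ⟨h00, h11⟩))).imp_right fun hi => ⟨i, hi⟩
    · exact ((h.isSquare j).eq_one_and_isTranslate_of_diagonal (x := 0) (y := 0) ha
        (.inr (by simpa using ⟨h10, h01⟩))).imp_right fun hj => ⟨j, hj⟩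
  · push Not at hdiag
    obtain rfl | hij := eq_or_ne i j
    · obtain rfl : k = m := by omega
      exact h.eq_one_and_exists_isTranslate_of_opposite_edges ha hdiag.1 h00 h10 h01 h11
    · obtain rfl : i = k := by omega
      obtain rfl : j = m := by omega
      have hrefl := h.image diagReflection
      rw [diagReflection_image_stdSquare] at hrefl
      obtain ⟨rfl, n, hn⟩ := hrefl.eq_one_and_exists_isTranslate_of_opposite_edges ha hij
        (mem_image_diagReflection.2 h00) (mem_image_diagReflection.2 h01)
        (mem_image_diagReflection.2 h10) (mem_image_diagReflection.2 h11)
      rw [← diagReflection_image_stdSquare] at hn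
      exact ⟨rfl, n, hn.of_image⟩

lemma eq_one_and_exists_isTranslate {F : Fin 2 → Set Plane} (h : BoundaryCover F S)
    (hS : IsSquareOfEdge a S) (ha : 1 ≤ a) : a = 1 ∧ ∃ i, IsTranslate (F i) S := by
  obtain ⟨g, hg⟩ := hS.exists_image_eq
  have himage := h.image g
  rw [hg] at himage
  obtain ⟨rfl, i, hi⟩ := himage.eq_one_and_exists_isTranslate_of_stdSquare ha
  rw [← hg] at hi
  exact ⟨rfl, i, hi.of_image⟩

end BoundaryCover

/-! ### The extremal squares -/

/-- The rotation `rot θ` as an isometry of the plane. -/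
noncomputable def rotIso (θ : ℝ) : Plane ≃ᵢ Plane where
  toFun := rot θ
  invFun := rot (-θ)
  left_inv x := by
    ext i
    fin_cases i <;> simp [rot]
    · linear_combination x 0 * Real.cos_sq_add_sin_sq θ
    · linear_combination x 1 * Real.cos_sq_add_sin_sq θ
  right_inv x := by
    ext i
    fin_cases i <;> simp [rot]
    · linear_combination x 0 * Real.cos_sq_add_sin_sq θ
    · linear_combination x 1 * Real.cos_sq_add_sin_sq θ
  isometry_toFun := Isometry.of_dist_eq fun x y => by
    simp only [EuclideanSpace.dist_eq, Fin.sum_univ_two, Real.dist_eq, sq_abs]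
    congr 1
    simp [rot]
    linear_combination ((x 0 - y 0) ^ 2 + (x 1 - y 1) ^ 2) * Real.cos_sq_add_sin_sq θ

lemma mem_image_rot {θ x y a : ℝ} : !₂[x, y] ∈ rot θ '' stdSquare a ↔
    Real.cos θ * x + Real.sin θ * y ∈ Set.Icc 0 a ∧
      Real.cos θ * y - Real.sin θ * x ∈ Set.Icc 0 a := by
  change !₂[x, y] ∈ rotIso θ '' stdSquare a ↔ _
  rw [← IsometryEquiv.preimage_symm, ← mem_stdSquare]
  change rot (-θ) !₂[x, y] ∈ stdSquare a ↔ _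
  simp [rot, sub_eq_add_neg, add_comm]

lemma diagReflection_image_image_rot_neg (θ a : ℝ) :
    diagReflection '' (rot (-θ) '' stdSquare a) = rot θ '' stdSquare a :=
  Plane.set_ext fun x y => by
    rw [mem_image_diagReflection, mem_image_rot, mem_image_rot, Real.cos_neg, Real.sin_neg,
      and_comm, neg_mul, neg_mul, sub_neg_eq_add, ← sub_eq_add_neg]

lemma cos_arccos_one_div_sqrtPhi : Real.cos (Real.arccos (1 / sqrtPhi)) = 1 / sqrtPhi := by
  have h0 : 0 < 1 / sqrtPhi := one_div_pos.2 sqrtPhi_pos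
  refine Real.cos_arccos (by linarith) ?_
  rw [div_le_one sqrtPhi_pos]
  linarith [lt_sqrtPhi]

lemma sin_arccos_one_div_sqrtPhi : Real.sin (Real.arccos (1 / sqrtPhi)) = 1 / sqrtPhi ^ 2 := by
  have hr := sqrtPhi_pos
  have hsq : 1 - (1 / sqrtPhi) ^ 2 = (1 / sqrtPhi ^ 2) ^ 2 := by
    field_simp
    linarith [sqrtPhi_pow_four]
  rw [Real.sin_arccos, hsq, Real.sqrt_sq (by positivity)]

lemma extremalSquares_zero :
    extremalSquares 0 = tiltedSquare 1 (1 / sqrtPhi ^ 2) (1 / sqrtPhi) 0 (-1) := by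
  refine Plane.set_ext fun x y => ?_
  change _ ∈ rot _ '' _ ↔ _
  rw [mem_image_rot, mem_tiltedSquare, Real.cos_neg, Real.sin_neg, cos_arccos_one_div_sqrtPhi,
    sin_arccos_one_div_sqrtPhi]
  simp only [Set.mem_Icc]
  grind

lemma extremalSquares_one : extremalSquares 1 = diagReflection '' extremalSquares 0 :=
  (diagReflection_image_image_rot_neg _ _).symm

lemma mem_extremalSquares_zero {x y : ℝ} : !₂[x, y] ∈ extremalSquares 0 ↔
    x + sqrtPhi * y ∈ Set.Icc 0 (sqrtPhi ^ 2) ∧ sqrtPhi * x - y ∈ Set.Icc 0 (sqrtPhi ^ 2) := by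
  have hr := sqrtPhi_pos
  have hu : 1 / sqrtPhi ^ 2 * x + 1 / sqrtPhi * y = (x + sqrtPhi * y) / sqrtPhi ^ 2 := by field_simp
  have hv : -(1 / sqrtPhi) * x + 1 / sqrtPhi ^ 2 * y = -((sqrtPhi * x - y) / sqrtPhi ^ 2) := by
    field_simp
    ring
  rw [extremalSquares_zero, mem_tiltedSquare, hu, hv]
  simp only [Set.mem_Icc, zero_add, neg_add_cancel, neg_le_neg_iff, neg_nonpos]
  rw [div_le_one (by positivity), div_le_one (by positivity), le_div_iff₀ (by positivity),
    le_div_iff₀ (by positivity), zero_mul, and_comm (a := _ ≤ _ ^ 2) (b := 0 ≤ sqrtPhi * x - y)]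

lemma mem_extremalSquares_one {x y : ℝ} :
    !₂[x, y] ∈ extremalSquares 1 ↔ !₂[y, x] ∈ extremalSquares 0 := by
  rw [extremalSquares_one, mem_image_diagReflection]

lemma mem_extremalSquares_two {x y : ℝ} : !₂[x, y] ∈ extremalSquares 2 ↔
    x ∈ Set.Icc (sqrtPhi - 1) sqrtPhi ∧ y ∈ Set.Icc (sqrtPhi - 1) sqrtPhi := by
  have hr := sqrtPhi_pos
  let h : ℝ → Plane →ᵃ[ℝ] Plane := AffineMap.homothety !₂[sqrtPhi, sqrtPhi]
  have hinv {k k' : ℝ} (hk : k * k' = 1) (z : Plane) : h k (h k' z) = z := by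
    rw [← AffineMap.homothety_mul_apply, hk, AffineMap.homothety_one, AffineMap.id_apply]
  have hcoord : h sqrtPhi !₂[x, y] =
      !₂[sqrtPhi * (x - (sqrtPhi - 1)), sqrtPhi * (y - (sqrtPhi - 1))] := by
    ext i
    fin_cases i <;> simp [h, AffineMap.homothety_apply] <;> ring
  change _ ∈ h (1 / sqrtPhi) '' stdSquare sqrtPhi ↔ _
  rw [Set.mem_image_iff_of_inverse (g := h sqrtPhi) (hinv (by field_simp)) (hinv (by field_simp)),
    hcoord, mem_stdSquare]
  simp only [Set.mem_Icc, mul_nonneg_iff_of_pos_left hr, mul_le_iff_le_one_right hr, sub_nonneg,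
    sub_le_iff_le_add, add_sub_cancel]

lemma isTranslate_extremalSquares_two : IsTranslate (extremalSquares 2) (stdSquare 1) := by
  refine ⟨!₂[sqrtPhi - 1, sqrtPhi - 1], Plane.set_ext fun x y => ?_⟩
  rw [mem_extremalSquares_two, Set.image_add_right, Set.mem_preimage]
  simp [stdSquare, Fin.forall_fin_two, ← sub_eq_add_neg]

lemma isSquareOfEdge_extremalSquares (i : Fin 3) : IsSquareOfEdge 1 (extremalSquares i) := by
  fin_cases i
  · exact ⟨one_pos, rotIso _, rfl⟩
  · exact ⟨one_pos, rotIso _, rfl⟩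
  · obtain ⟨v, hv⟩ := isTranslate_extremalSquares_two
    exact ⟨one_pos, IsometryEquiv.addRight v, hv⟩

lemma mem_extremalSquares_of_le {x y : ℝ} (hx : x ∈ Set.Icc 0 sqrtPhi)
    (hy : y ∈ Set.Icc 0 (sqrtPhi - 1)) : !₂[x, y] ∈ extremalSquares 0 ∪ extremalSquares 1 := by
  obtain ⟨hx0, hxr⟩ := hx
  obtain ⟨hy0, hyr⟩ := hy
  have hr := lt_sqrtPhi
  rw [Set.mem_union, mem_extremalSquares_one, mem_extremalSquares_zero, mem_extremalSquares_zero]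
  simp only [Set.mem_Icc]
  obtain h | h := le_total y (sqrtPhi * x)
  · left
    refine ⟨⟨by positivity, by nlinarith⟩, by linarith, by nlinarith⟩
  · right
    refine ⟨⟨by positivity, by nlinarith⟩, by nlinarith, by nlinarith⟩

lemma stdSquare_sqrtPhi_subset : stdSquare sqrtPhi ⊆ ⋃ i, extremalSquares i :=
  Plane.set_subset fun x y h => by
    obtain ⟨hx, hy⟩ := mem_stdSquare.1 h
    rw [Set.mem_iUnion, Fin.exists_fin_succ, Fin.exists_fin_two, ← or_assoc]
    by_cases hy' : y ≤ sqrtPhi - 1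
    · exact .inl (mem_extremalSquares_of_le hx ⟨hy.1, hy'⟩)
    by_cases hx' : x ≤ sqrtPhi - 1
    · exact .inl ((mem_extremalSquares_of_le hy ⟨hx.1, hx'⟩).symm.imp
        mem_extremalSquares_one.1 mem_extremalSquares_one.2)
    · exact .inr (mem_extremalSquares_two.2 ⟨⟨by linarith, hx.2⟩, by linarith, hy.2⟩)

/-! ### Three squares -/

lemma IsSquareOfEdge.notMem_of_one_lt {Q : Set Plane} (hQ : IsSquareOfEdge 1 Q) {x y d : ℝ}
    (hd : 1 < d) (h : !₂[x, y] ∈ Q) (hx : !₂[x + d, y] ∈ Q) (z : ℝ) : !₂[z, y + d] ∉ Q := by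
  intro hz
  obtain ⟨c, s, e, f, hc, hs, hcs, rfl⟩ := hQ.exists_tiltedSquare
  simp only [mem_tiltedSquare, Set.mem_Icc] at h hx hz
  exact hd.ne' (eq_one_of_trapezoid (l := x + d - z) (t := z - x) hd.le hs hc (by linarith)
    (by linarith) (by linarith) (by linarith)).1

lemma IsSquareOfEdge.eq_extremalSquares_zero {Q : Set Plane} (hQ : IsSquareOfEdge 1 Q)
    (h : !₂[0, 0] ∈ Q) (hx : !₂[sqrtPhi, 0] ∈ Q) (hy : !₂[sqrtPhi, sqrtPhi - 1] ∈ Q) :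
    Q = extremalSquares 0 := by
  have hr := lt_sqrtPhi
  obtain ⟨c, s, e, f, hc, hs, hcs, rfl⟩ := hQ.exists_tiltedSquare
  simp only [mem_tiltedSquare, Set.mem_Icc] at h hx hy
  have hs' : sqrtPhi * s = 1 := by
    refine mul_eq_one_of_mul_add_maxLeg_mul_le_one (s := c) (by linarith) hs hc (by linarith)
      (by linarith) ?_
    rw [maxLeg_sqrtPhi]
    linarith
  obtain rfl : s = 1 / sqrtPhi := by field_simp; linarith
  obtain rfl : c = 1 / sqrtPhi ^ 2 := by
    rw [← sin_arccos_one_div_sqrtPhi, Real.sin_arccos, ← eq_sub_of_add_eq hcs,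
      Real.sqrt_sq hc]
  have h1 : 1 / sqrtPhi ^ 2 * sqrtPhi = 1 / sqrtPhi := by field_simp
  obtain rfl : e = 0 := by linarith
  obtain rfl : f = -1 := by linarith
  exact extremalSquares_zero.symm

lemma IsTranslate.mem_iff_of_antidiagonal {Q : Set Plane} {a x y : ℝ}
    (hQ : IsTranslate Q (stdSquare a)) (hx : !₂[x + a, y] ∈ Q) (hy : !₂[x, y + a] ∈ Q)
    {x' y' : ℝ} : !₂[x', y'] ∈ Q ↔ x' ∈ Set.Icc x (x + a) ∧ y' ∈ Set.Icc y (y + a) := by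
  obtain ⟨v, rfl⟩ := hQ
  simp only [Set.image_add_right, Set.mem_preimage, stdSquare, Set.mem_ofPred_eq,
    Fin.forall_fin_two, PiLp.add_apply, PiLp.neg_apply, Matrix.cons_val_zero,
    Matrix.cons_val_one, Set.mem_Icc] at *
  grind

/-- The unit squares `F 0`, `F 1`, `F 2` contain, respectively, the arcs of the boundary of
`stdSquare a` from `(0, l)` through the two bottom corners to `(a, t)`, from `(0, l)` through the
corner `(0, a)` to `(p, a)`, and from `(a, t)` through the corner `(a, a)` to `(p, a)`.
Only the corners and the endpoints of the arcs are recorded, as all squares are convex. -/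
structure ArcSplit (F : Fin 3 → Set Plane) (a l t p : ℝ) : Prop where
  isSquare : ∀ i, IsSquareOfEdge 1 (F i)
  left_nonneg : 0 ≤ l
  right_nonneg : 0 ≤ t
  bottom_left : !₂[0, 0] ∈ F 0
  bottom_right : !₂[a, 0] ∈ F 0
  top_left : !₂[0, a] ∈ F 1
  top_right : !₂[a, a] ∈ F 2
  left : !₂[0, l] ∈ F 0 ∧ !₂[0, l] ∈ F 1
  right : !₂[a, t] ∈ F 0 ∧ !₂[a, t] ∈ F 2
  top : !₂[p, a] ∈ F 1 ∧ !₂[p, a] ∈ F 2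

/-- The family `F` is, up to a congruence carrying `S` to `stdSquare sqrtPhi` and up to the order,
the family of the three extremal squares. -/
def IsExtremal (F : Fin 3 → Set Plane) (S : Set Plane) : Prop :=
  ∃ (g : Plane ≃ᵢ Plane) (σ : Equiv.Perm (Fin 3)),
    g '' S = stdSquare sqrtPhi ∧ ∀ i, g '' F (σ i) = extremalSquares i

namespace IsExtremal

variable {F : Fin 3 → Set Plane} {S : Set Plane}

lemma of_image {g : Plane ≃ᵢ Plane} (h : IsExtremal (fun i => g '' F i) (g '' S)) :
    IsExtremal F S := by
  obtain ⟨k, σ, hS, hF⟩ := h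
  exact ⟨g.trans k, σ, (Set.image_comp k g S).trans hS,
    fun i => (Set.image_comp k g (F (σ i))).trans (hF i)⟩

lemma of_comp {σ : Equiv.Perm (Fin 3)} (h : IsExtremal (F ∘ σ) S) : IsExtremal F S := by
  obtain ⟨g, τ, hS, hF⟩ := h
  exact ⟨g, τ.trans σ, hS, hF⟩

end IsExtremal

namespace ArcSplit

variable {F : Fin 3 → Set Plane} {a l t p : ℝ}

lemma mirror (h : ArcSplit F a l t p) :
    ArcSplit (fun i => mirror a '' F (Equiv.swap 1 2 i)) a t l (a - p) where
  isSquare i := (h.isSquare _).image _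
  left_nonneg := h.right_nonneg
  right_nonneg := h.left_nonneg
  bottom_left := mem_image_mirror.2 (show _ ∈ F 0 by simpa using h.bottom_right)
  bottom_right := mem_image_mirror.2 (show _ ∈ F 0 by simpa using h.bottom_left)
  top_left := mem_image_mirror.2 (show _ ∈ F 2 by simpa using h.top_right)
  top_right := mem_image_mirror.2 (show _ ∈ F 1 by simpa using h.top_left)
  left := (and_congr mem_image_mirror mem_image_mirror).2
    (show _ ∈ F 0 ∧ _ ∈ F 2 by simpa using h.right)
  right := (and_congr mem_image_mirror mem_image_mirror).2
    (show _ ∈ F 0 ∧ _ ∈ F 1 by simpa using h.left)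
  top := (and_congr mem_image_mirror mem_image_mirror).2
    (show _ ∈ F 2 ∧ _ ∈ F 1 by simpa using h.top.symm)

lemma height_le_or_height_le (h : ArcSplit F a l t p) (ha : sqrtPhi ≤ a) :
    (l ≤ 1 / 6 ∧ t + l / 2 ≤ sqrtPhi - 1) ∨ (t ≤ 1 / 6 ∧ l + t / 2 ≤ sqrtPhi - 1) := by
  obtain ⟨c, s, e, f, hc, hs, hcs, h0⟩ := (h.isSquare 0).exists_tiltedSquare
  have h00 := h.bottom_left
  have h10 := h.bottom_right
  have hl := h.left.1
  have ht := h.right.1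
  simp only [h0, mem_tiltedSquare, Set.mem_Icc] at h00 h10 hl ht
  have hsc : s ^ 2 + c ^ 2 = 1 := by linarith
  have hleft : sqrtPhi * s + l * c ≤ 1 := by nlinarith
  have hright : sqrtPhi * c + t * s ≤ 1 := by nlinarith
  obtain hle | hle := le_total c s
  · exact .inl ⟨left_height_le hc hle hcs h.left_nonneg hleft,
      right_height_le hc (by nlinarith) hcs h.left_nonneg hleft hright⟩
  · exact .inr ⟨left_height_le hs hle hsc h.right_nonneg hright,
      right_height_le hs (by nlinarith) hsc h.right_nonneg hright hleft⟩

lemma eq_sqrtPhi (h : ArcSplit F a l t p) (ha : sqrtPhi ≤ a) (hl : l ≤ 1 / 6)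
    (ht : t + l / 2 ≤ sqrtPhi - 1) :
    a = sqrtPhi ∧ l = 0 ∧ t = sqrtPhi - 1 ∧ p = sqrtPhi - 1 := by
  have hr := lt_sqrtPhi
  have hl0 := h.left_nonneg
  have hl' : |l - a| = a - l := by rw [abs_sub_comm, abs_of_nonneg (by linarith)]
  have ht' : |t - a| = a - t := by rw [abs_sub_comm, abs_of_nonneg (by linarith)]
  have hp := (h.isSquare 1).abs_sub_le_maxLeg_swap h.top_left h.top.1 h.left.2 (by linarith)
  have hq := (h.isSquare 2).abs_sub_le_maxLeg_swap h.top_right h.top.2 h.right.2 (by linarith)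
  rw [hl'] at hp
  rw [ht', abs_sub_comm] at hq
  exact eq_of_le_maxLeg ha hl0 hl ht (by linarith [le_abs_self (p - 0)])
    ((le_abs_self _).trans hq)

lemma eq_extremalSquares (h : ArcSplit F sqrtPhi 0 (sqrtPhi - 1) (sqrtPhi - 1)) :
    F = extremalSquares := by
  have h0 := (h.isSquare 0).eq_extremalSquares_zero h.bottom_left h.bottom_right h.right.1
  have h1 := ((h.isSquare 1).image diagReflection).eq_extremalSquares_zero
    (mem_image_diagReflection.2 h.left.2) (mem_image_diagReflection.2 h.top_left)
    (mem_image_diagReflection.2 h.top.1)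
  have hx : !₂[sqrtPhi - 1 + 1, sqrtPhi - 1] ∈ F 2 := by simpa using h.right.2
  have hy : !₂[sqrtPhi - 1, sqrtPhi - 1 + 1] ∈ F 2 := by simpa using h.top.2
  have h2 := ((h.isSquare 2).eq_one_and_isTranslate_of_diagonal le_rfl (.inr ⟨hx, hy⟩)).2
  funext i
  fin_cases i
  · exact h0
  · refine Plane.set_ext fun x y => ?_
    rw [Fin.mk_one, mem_extremalSquares_one, ← h1, mem_image_diagReflection]
  · refine Plane.set_ext fun x y => ?_
    change _ ∈ F 2 ↔ _ ∈ extremalSquares 2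
    rw [h2.mem_iff_of_antidiagonal hx hy, mem_extremalSquares_two, sub_add_cancel]

lemma isExtremal_of_height_le (h : ArcSplit F a l t p) (ha : sqrtPhi ≤ a) (hl : l ≤ 1 / 6)
    (ht : t + l / 2 ≤ sqrtPhi - 1) : a = sqrtPhi ∧ IsExtremal F (stdSquare a) := by
  obtain ⟨rfl, rfl, rfl, rfl⟩ := h.eq_sqrtPhi ha hl ht
  obtain rfl := h.eq_extremalSquares
  exact ⟨rfl, .refl _, .refl _, Set.image_id _, fun i => Set.image_id _⟩

lemma isExtremal (h : ArcSplit F a l t p) (ha : sqrtPhi ≤ a) :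
    a = sqrtPhi ∧ IsExtremal F (stdSquare a) := by
  obtain ⟨hl, ht⟩ | ⟨ht, hl⟩ := h.height_le_or_height_le ha
  · exact h.isExtremal_of_height_le ha hl ht
  · obtain ⟨rfl, hF⟩ := h.mirror.isExtremal_of_height_le ha ht hl
    rw [← mirror_image_stdSquare] at hF
    exact ⟨rfl, (IsExtremal.of_image (F := F ∘ Equiv.swap 1 2) hF).of_comp⟩

end ArcSplit

namespace BoundaryCover

variable {F : Fin 3 → Set Plane} {a : ℝ}

lemma exists_mem_inter_left {ι : Type*} {F : ι → Set Plane} (h : BoundaryCover F (stdSquare a))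
    (ha : sqrtPhi ≤ a) {i j k : ι} (hijk : ∀ m, m = i ∨ m = j ∨ m = k) (h00 : !₂[0, 0] ∈ F i)
    (h10 : !₂[a, 0] ∈ F i) (h11 : !₂[a, a] ∈ F k) :
    ∃ l, 0 ≤ l ∧ !₂[0, l] ∈ F i ∧ !₂[0, l] ∈ F j := by
  have hr := lt_sqrtPhi
  have haa : |a - 0| = a := by rw [sub_zero, abs_of_pos (by linarith)]
  have ha2 := (h.isSquare i).dist_sq_le h00 h10
  have hcov (y : ℝ) (hy : y ∈ Set.Icc 0 (1 / 2)) : !₂[0, y] ∈ F i ∪ F j := by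
    obtain ⟨m, hm⟩ := h.exists_mem (x := 0) (y := y) ⟨le_rfl, by linarith⟩
      ⟨hy.1, by linarith [hy.2]⟩ (by simp)
    obtain rfl | rfl | rfl := hijk m
    · exact .inl hm
    · exact .inr hm
    · nlinarith [(h.isSquare m).dist_sq_le hm h11, hy.2]
  have hhalf : !₂[0, 1 / 2] ∈ F j := by
    refine (hcov (1 / 2) (by norm_num)).resolve_left fun hi => ?_
    have hheight := (h.isSquare i).abs_sub_le_of_sqrtPhi_le h00 h10 (by rwa [haa]) (.inl rfl) hi
    rw [haa, sub_zero, abs_of_pos (by norm_num)] at hheight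
    nlinarith
  obtain ⟨l, hl, hli, hlj⟩ := exists_mem_inter_of_continuousOn (γ := fun y => !₂[0, y])
    (h.isSquare i).isClosed (h.isSquare j).isClosed (by fun_prop) (by norm_num) h00 hhalf hcov
  exact ⟨l, hl.1, hli, hlj⟩

lemma exists_mem_inter_right (h : BoundaryCover F (stdSquare a)) (ha : sqrtPhi ≤ a)
    (h00 : !₂[0, 0] ∈ F 0) (h10 : !₂[a, 0] ∈ F 0) (h01 : !₂[0, a] ∈ F 1) :
    ∃ t, 0 ≤ t ∧ !₂[a, t] ∈ F 0 ∧ !₂[a, t] ∈ F 2 := by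
  have hmirror := h.image (mirror a)
  rw [mirror_image_stdSquare] at hmirror
  obtain ⟨t, ht0, ht⟩ := hmirror.exists_mem_inter_left (i := 0) (j := 2) (k := 1) ha (by decide)
    (mem_image_mirror.2 (by simpa using h10)) (mem_image_mirror.2 (by simpa using h00))
    (mem_image_mirror.2 (by simpa using h01))
  rw [mem_image_mirror, mem_image_mirror, sub_zero] at ht
  exact ⟨t, ht0, ht⟩

lemma exists_arcSplit (h : BoundaryCover F (stdSquare a)) (ha : sqrtPhi ≤ a)
    (h00 : !₂[0, 0] ∈ F 0) (h10 : !₂[a, 0] ∈ F 0) (h01 : !₂[0, a] ∈ F 1) (h11 : !₂[a, a] ∈ F 2) :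
    ∃ l t p, ArcSplit F a l t p := by
  have hr := lt_sqrtPhi
  obtain ⟨l, hl0, hl⟩ := h.exists_mem_inter_left (i := 0) (j := 1) (k := 2) ha (by decide)
    h00 h10 h11
  obtain ⟨t, ht0, ht⟩ := h.exists_mem_inter_right ha h00 h10 h01
  obtain ⟨p, -, hp⟩ := exists_mem_inter_of_continuousOn (γ := fun x => !₂[x, a])
    (h.isSquare 1).isClosed (h.isSquare 2).isClosed (by fun_prop) (by linarith) h01 h11
    fun x hx => by
      obtain ⟨i, hi⟩ := h.exists_mem (y := a) hx ⟨by linarith, le_rfl⟩ (by simp)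
      fin_cases i
      · exact absurd (by simpa using hi) ((h.isSquare 0).notMem_of_one_lt (d := a)
          (by linarith) h00 (by simpa using h10) x)
      · exact .inl hi
      · exact .inr hi
  exact ⟨l, t, p, h.isSquare, hl0, ht0, h00, h10, h01, h11, hl, ht, hp⟩

lemma eq_of_opposite_edges (h : BoundaryCover F (stdSquare a)) (ha : sqrtPhi ≤ a) {i j : Fin 3}
    (h00 : !₂[0, 0] ∈ F i) (h10 : !₂[a, 0] ∈ F i) (h01 : !₂[0, a] ∈ F j) (h11 : !₂[a, a] ∈ F j) :
    i = j := by
  by_contra hij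
  have hr := lt_sqrtPhi
  have haa : |a - 0| = a := by rw [sub_zero, abs_of_pos (by linarith)]
  have ha2 := (h.isSquare i).dist_sq_le h00 h10
  have haub : a < 1.42 := by nlinarith
  obtain ⟨k, hk⟩ : ∃ k, ∀ m, m = i ∨ m = j ∨ m = k := by
    clear * - hij
    decide +revert
  have hthird {x y : ℝ} (hx : x = 0 ∨ x = a) (hy : y ∈ Set.Icc 0.5 0.95) : !₂[x, y] ∈ F k := by
    obtain ⟨m, hm⟩ := h.exists_mem (x := x) (y := y) (by grind) (by grind) (.inl hx)
    obtain rfl | rfl | rfl := hk m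
    · have hheight := (h.isSquare m).abs_sub_le_of_sqrtPhi_le h00 h10 (by rwa [haa]) hx hm
      grind
    · have hheight := (h.isSquare m).abs_sub_le_of_sqrtPhi_le h01 h11 (by rwa [haa]) hx hm
      grind
    · exact hm
  have hheight := (h.isSquare k).abs_sub_le_of_sqrtPhi_le (y := 0.5) (y' := 0.95)
    (hthird (.inl rfl) (by norm_num)) (hthird (.inr rfl) (by norm_num)) (by rwa [haa]) (.inl rfl)
    (hthird (.inl rfl) (by norm_num))
  grind

lemma isExtremal_of_bottom (h : BoundaryCover F (stdSquare a)) (ha : sqrtPhi ≤ a) {i : Fin 3}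
    (h00 : !₂[0, 0] ∈ F i) (h10 : !₂[a, 0] ∈ F i) :
    a = sqrtPhi ∧ IsExtremal F (stdSquare a) := by
  have hr := lt_sqrtPhi
  have h0 : (0 : ℝ) ∈ Set.Icc 0 a := Set.left_mem_Icc.2 (by linarith)
  have h1 : a ∈ Set.Icc 0 a := Set.right_mem_Icc.2 (by linarith)
  obtain ⟨j, h01⟩ := h.exists_mem h0 h1 (by simp)
  obtain ⟨k, h11⟩ := h.exists_mem h1 h1 (by simp)
  have htop {x : ℝ} : !₂[x, a] ∉ F i := by
    simpa using (h.isSquare i).notMem_of_one_lt (d := a) (by linarith) h00 (by simpa using h10) x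
  have hij : i ≠ j := by rintro rfl; exact htop h01
  have hik : i ≠ k := by rintro rfl; exact htop h11
  have hjk : j ≠ k := by rintro rfl; exact hij (h.eq_of_opposite_edges ha h00 h10 h01 h11)
  obtain ⟨σ, rfl, rfl, rfl⟩ : ∃ σ : Equiv.Perm (Fin 3), σ 0 = i ∧ σ 1 = j ∧ σ 2 = k := by
    clear * - hij hik hjk
    decide +revert
  obtain ⟨l, t, p, hsplit⟩ := (h.comp_equiv σ).exists_arcSplit ha h00 h10 h01 h11
  exact (hsplit.isExtremal ha).imp_right IsExtremal.of_comp

lemma isExtremal_of_left (h : BoundaryCover F (stdSquare a)) (ha : sqrtPhi ≤ a) {i : Fin 3}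
    (h00 : !₂[0, 0] ∈ F i) (h01 : !₂[0, a] ∈ F i) :
    a = sqrtPhi ∧ IsExtremal F (stdSquare a) := by
  have hdiag := h.image diagReflection
  rw [diagReflection_image_stdSquare] at hdiag
  obtain ⟨rfl, hF⟩ := hdiag.isExtremal_of_bottom ha (mem_image_diagReflection.2 h00)
    (mem_image_diagReflection.2 h01)
  rw [← diagReflection_image_stdSquare] at hF
  exact ⟨rfl, hF.of_image⟩

lemma isExtremal_of_right (h : BoundaryCover F (stdSquare a)) (ha : sqrtPhi ≤ a) {i : Fin 3}
    (h10 : !₂[a, 0] ∈ F i) (h11 : !₂[a, a] ∈ F i) :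
    a = sqrtPhi ∧ IsExtremal F (stdSquare a) := by
  have hmirror := h.image (mirror a)
  rw [mirror_image_stdSquare] at hmirror
  obtain ⟨rfl, hF⟩ := hmirror.isExtremal_of_left ha (mem_image_mirror.2 (by simpa using h10))
    (mem_image_mirror.2 (by simpa using h11))
  rw [← mirror_image_stdSquare] at hF
  exact ⟨rfl, hF.of_image⟩

lemma isExtremal_of_top (h : BoundaryCover F (stdSquare a)) (ha : sqrtPhi ≤ a) {i : Fin 3}
    (h01 : !₂[0, a] ∈ F i) (h11 : !₂[a, a] ∈ F i) :
    a = sqrtPhi ∧ IsExtremal F (stdSquare a) := by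
  have hdiag := h.image diagReflection
  rw [diagReflection_image_stdSquare] at hdiag
  obtain ⟨rfl, hF⟩ := hdiag.isExtremal_of_right ha (mem_image_diagReflection.2 h01)
    (mem_image_diagReflection.2 h11)
  rw [← diagReflection_image_stdSquare] at hF
  exact ⟨rfl, hF.of_image⟩

lemma isExtremal_of_stdSquare (h : BoundaryCover F (stdSquare a)) (ha : sqrtPhi ≤ a) :
    a = sqrtPhi ∧ IsExtremal F (stdSquare a) := by
  have hr := lt_sqrtPhi
  have h0 : (0 : ℝ) ∈ Set.Icc 0 a := Set.left_mem_Icc.2 (by linarith)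
  have h1 : a ∈ Set.Icc 0 a := Set.right_mem_Icc.2 (by linarith)
  obtain ⟨i, h00⟩ := h.exists_mem h0 h0 (by simp)
  obtain ⟨j, h10⟩ := h.exists_mem h1 h0 (by simp)
  obtain ⟨k, h01⟩ := h.exists_mem h0 h1 (by simp)
  obtain ⟨m, h11⟩ := h.exists_mem h1 h1 (by simp)
  have him : i ≠ m := by rintro rfl; nlinarith [(h.isSquare i).dist_sq_le h00 h11]
  have hjk : j ≠ k := by rintro rfl; nlinarith [(h.isSquare j).dist_sq_le h10 h01]
  obtain rfl | rfl | rfl | rfl : i = j ∨ i = k ∨ j = m ∨ k = m := by omega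
  · exact h.isExtremal_of_bottom ha h00 h10
  · exact h.isExtremal_of_left ha h00 h01
  · exact h.isExtremal_of_right ha h10 h11
  · exact h.isExtremal_of_top ha h01 h11

lemma isExtremal {S : Set Plane} (h : BoundaryCover F S) (hS : IsSquareOfEdge a S)
    (ha : sqrtPhi ≤ a) : a = sqrtPhi ∧ IsExtremal F S := by
  obtain ⟨g, hg⟩ := hS.exists_image_eq
  have himage := h.image g
  rw [hg] at himage
  obtain ⟨rfl, hF⟩ := himage.isExtremal_of_stdSquare ha
  rw [← hg] at hF
  exact ⟨rfl, hF.of_image⟩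

end BoundaryCover

/-! ### The maximal edge lengths -/

lemma coverableEdges_subset_bdCoverableEdges (n : ℕ) : coverableEdges n ⊆ bdCoverableEdges n := by
  rintro a ⟨S, F, hS, hF, hcov⟩
  exact ⟨S, F, hS, hF, hS.isClosed.frontier_subset.trans hcov⟩

lemma isSbd_and_isS_of_forall_eq {n : ℕ} {s : ℝ} (hs : s ∈ coverableEdges n)
    (heq : ∀ {S : Set Plane} {F : Fin n → Set Plane} {a : ℝ}, BoundaryCover F S →
      IsSquareOfEdge a S → s ≤ a → a = s) : IsSbd n s ∧ IsS n s := by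
  have hub : s ∈ upperBounds (bdCoverableEdges n) := by
    rintro a ⟨S, F, hS, hF, hcov⟩
    obtain h | h := le_total s a
    exacts [(heq ⟨hF, hcov⟩ hS h).le, h]
  have hsub := coverableEdges_subset_bdCoverableEdges n
  exact ⟨⟨hsub hs, hub⟩, hs, upperBounds_mono_set hsub hub⟩

lemma one_mem_coverableEdges_two : 1 ∈ coverableEdges 2 :=
  ⟨stdSquare 1, fun _ => stdSquare 1, isSquareOfEdge_stdSquare one_pos,
    fun _ => isSquareOfEdge_stdSquare one_pos, (Set.iUnion_const _).symm.subset⟩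

lemma sqrtPhi_mem_coverableEdges_three : sqrtPhi ∈ coverableEdges 3 :=
  ⟨stdSquare sqrtPhi, extremalSquares, isSquareOfEdge_stdSquare sqrtPhi_pos,
    isSquareOfEdge_extremalSquares, stdSquare_sqrtPhi_subset⟩

theorem theorem1 :
    (IsSbd 2 1 ∧ IsS 2 1) ∧
    (IsSbd 3 sqrtPhi ∧ IsS 3 sqrtPhi) ∧
    (∀ (S : Set Plane) (F : Fin 2 → Set Plane),
      IsSquareOfEdge 1 S → (∀ i, IsSquareOfEdge 1 (F i)) → frontier S ⊆ ⋃ i, F i →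
        ∃ (i : Fin 2) (v : Plane), F i = (fun x => x + v) '' S) ∧
    (∀ (S : Set Plane) (F : Fin 3 → Set Plane),
      IsSquareOfEdge sqrtPhi S → (∀ i, IsSquareOfEdge 1 (F i)) → frontier S ⊆ ⋃ i, F i →
        ∃ (g : Plane ≃ᵢ Plane) (σ : Equiv.Perm (Fin 3)),
          g '' S = stdSquare sqrtPhi ∧ ∀ i, g '' F (σ i) = extremalSquares i) := by
  refine ⟨?_, ?_, fun S F hS hF hcov => ?_, fun S F hS hF hcov => ?_⟩
  · exact isSbd_and_isS_of_forall_eq one_mem_coverableEdges_two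
      fun h hS ha => (h.eq_one_and_exists_isTranslate hS ha).1
  · exact isSbd_and_isS_of_forall_eq sqrtPhi_mem_coverableEdges_three
      fun h hS ha => (h.isExtremal hS ha).1
  · exact (BoundaryCover.eq_one_and_exists_isTranslate ⟨hF, hcov⟩ hS le_rfl).2
  · exact (BoundaryCover.isExtremal ⟨hF, hcov⟩ hS le_rfl).2
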